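/- Let $n\ge 0$ and let $\mathbb{T}^n=\mathbb{R}^n/\mathbb{Z}^n=(S^1)^n$ be the $n$-torus. A (toric) hyperplane in $\mathbb{T}^n$ is a set $\theta^{-1}(b)$, where $\theta:\mathbb{T}^n\to S^1$ is a continuous surjective group homomorphism and $b\in S^1$ (it need not be connected). A toric hyperplane arrangement $(\mathcal{A},\mathbb{T}^n)$ is a finite set $\mathcal{A}$ of hyperplanes in $\mathbb{T}^n$. The arrangement is in general position if for every subset $S\subseteq\mathcal{A}$ with $|S|\le n$ one has $\dim\bigcap_{H\in S}H\le n-|S|$ (the intersection may be empty), and for every subset $S\subseteq\mathcal{A}$ with $|S|>n$ one has $\bigcap_{H\in S}H=\emptyset$. It is spanning if there is a subset $S\subseteq\mathcal{A}$ with $|S|=n$ and $\bigcap_{H\in S}H\ne\emptyset$. (The intersection over the empty set is $\mathbb{T}^n$.) Write $\pi_0(X)$ for the set of connected components of $X$. The sets $\Sigma_k(\mathcal{A})$ of $k$-flats are defined inductively: for $0\le k<n$, $$\Sigma_k(\mathcal{A})=\bigcup_{\substack{S\subseteq\mathcal{A}\\ |S|=n-k}}\pi_0\Bigl(\bigcap_{H\in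 S}H\ \setminus\ \bigcup_{j<k}\ \bigcup_{\sigma\in\Sigma_j(\mathcal{A})}\sigma\Bigr),\qquad\text{and}\qquad \Sigma_n(\mathcal{A})=\pi_0\Bigl(\mathbb{T}^n\setminus\bigcup_{H\in\mathcal{A}}H\Bigr).$$ Put $f_k(\mathcal{A})=|\Sigma_k(\mathcal{A})|$; the $f$-vector of $\mathcal{A}$ is $(f_0(\mathcal{A}),f_1(\mathcal{A}),\dots,f_n(\mathcal{A}))$. Theorem (Symmetry of $f$-vectors). Let $(\mathcal{A},\mathbb{T}^n)$ be a spanning toric hyperplane arrangement in general position with $|\mathcal{A}|\ge n$. Then for every $0\le k\le n$ the set $\Sigma_k(\mathcal{A})$ is finite and there is a bijection between $\Sigma_k(\mathcal{A})$ and $\Sigma_{n-k}(\mathcal{A})$. In particular $f_k(\mathcal{A})=f_{n-k}(\mathcal{A})$ for every $0\le k\le n$, that is, the $f$-vector of $\mathcal{A}$ is symmetric. -/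

import Mathlib

open Set
open scoped ENNReal

noncomputable section

/-- An (affine) toric hyperplane in the `n`-torus: the preimage of a point of the circle under a
continuous surjective group homomorphism to the circle. It need not be connected. -/
def IsToricHyperplane {n : ℕ} (H : Set (UnitAddTorus (Fin n))) : Prop :=
  ∃ (θ : UnitAddTorus (Fin n) →+ UnitAddCircle) (b : UnitAddCircle),
    Continuous θ ∧ Function.Surjective θ ∧ H = θ ⁻¹' {b}

/-- A toric hyperplane arrangement in the `n`-torus: a finite set of toric hyperplanes. -/
structure ToricArrangement (n : ℕ) where
  hyperplanes : Finset (Set (UnitAddTorus (Fin n)))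
  isToricHyperplane : ∀ H ∈ hyperplanes, IsToricHyperplane H

namespace ToricArrangement

variable {n : ℕ} (A : ToricArrangement n)

/-- General position: `m ≤ n` distinct hyperplanes meet in dimension at most `n - m` (the
intersection may be empty), and more than `n` distinct hyperplanes do not meet. An intersection of
hyperplanes is empty or a compact submanifold (a finite union of translates of a subtorus), so its
dimension as a manifold is its Hausdorff dimension. -/
def InGeneralPosition : Prop :=
  (∀ S ⊆ A.hyperplanes, S.card ≤ n → dimH (⋂ H ∈ S, H) ≤ ((n - S.card : ℕ) : ℝ≥0∞)) ∧
    ∀ S ⊆ A.hyperplanes, n < S.card → (⋂ H ∈ S, H) = ∅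

/-- An arrangement is spanning if some `n` of its hyperplanes have a common point. -/
def IsSpanning : Prop :=
  ∃ S ⊆ A.hyperplanes, S.card = n ∧ (⋂ H ∈ S, H).Nonempty

end ToricArrangement

/-- The set of connected components of a subset `F` of a topological space, each regarded as a
subset of that space. -/
def componentsOf {X : Type*} [TopologicalSpace X] (F : Set X) : Set (Set X) :=
  {C | ∃ x ∈ F, C = connectedComponentIn F x}

namespace ToricArrangement

variable {n : ℕ} (A : ToricArrangement n)

/-- The set `Σ_k` of `k`-flats. For `k < n`, these are the components of
`⋂ H ∈ S, H` minus all flats of smaller dimension, for the sets `S` of `n - k` hyperplanes; the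
`n`-flats are the components of the complement of the union of all hyperplanes. -/
def flats (k : ℕ) : Set (Set (UnitAddTorus (Fin n))) :=
  if k < n then
    {C | ∃ S ⊆ A.hyperplanes, S.card = n - k ∧
      C ∈ componentsOf ((⋂ H ∈ S, H) \ ⋃ j : Fin k, ⋃₀ flats j)}
  else if k = n then
    componentsOf (univ \ ⋃ H ∈ A.hyperplanes, H)
  else ∅
termination_by k
decreasing_by exact j.isLt

/-- The number `f_k` of `k`-flats. -/
def numFlats (k : ℕ) : ℕ := (A.flats k).ncard

/-- The `f`-vector `(f_0, f_1, …, f_n)`. -/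
def fVector : Fin (n + 1) → ℕ := fun k => A.numFlats k

end ToricArrangement

end

open Set
open scoped ENNReal

noncomputable section

/-! Lift the arrangement to a `ℤⁿ`-periodic arrangement of affine hyperplanes in `ℝⁿ`; flats of the
torus become lattice orbits of relatively open polyhedral cells (`flats_eq_image`). Spanning makes
the closed cells compact, so a linear height `l` attains its minimum on each of them. If `l` is
generic, this minimum is at a unique point, and exactly `n` hyperplanes with independent normals
pass through it.

Near a vertex `v` the arrangement looks like the coordinate hyperplanes. A cell with lowest point
`v` is determined by the set `T` of hyperplanes containing it (`IsBottom.code_eq`), and every subset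
`T` of the hyperplanes through `v` occurs (`exists_isBottom_of_subset`). Everything commutes with
lattice translations, so `k`-flats correspond to pairs of a vertex of the torus and `n - k` of the
`n` hyperplanes through it. Complementing the subset exchanges `k` and `n - k`; in fact `f_k = f_0 *
(n choose k)`. -/

/-- The projection from `ℝⁿ` to the `n`-torus. -/
def torusMk (n : ℕ) : (Fin n → ℝ) →+ UnitAddTorus (Fin n) where
  toFun x i := (x i : UnitAddCircle)
  map_zero' := rfl
  map_add' _ _ := rfl

/-- The inclusion of the integer lattice in `ℝⁿ`. -/
def intVec {n : ℕ} (z : Fin n → ℤ) : Fin n → ℝ := fun i => z i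

/-! ### The torus as a quotient of `ℝⁿ`, lifts and dimension. -/

section Torus

variable {n : ℕ}

theorem torusMk_apply (x : Fin n → ℝ) (i : Fin n) : torusMk n x i = (x i : UnitAddCircle) := rfl

theorem continuous_torusMk : Continuous (torusMk n) :=
  continuous_pi fun i => (AddCircle.continuous_mk' (1 : ℝ)).comp (continuous_apply i)

theorem surjective_torusMk : Function.Surjective (torusMk n) := fun v => by
  choose x hx using fun i => QuotientAddGroup.mk_surjective (v i)
  exact ⟨x, funext hx⟩

theorem isOpenMap_torusMk : IsOpenMap (torusMk n) := by
  have : IsOpenMap (Pi.map (fun (_ : Fin n) (t : ℝ) => (t : UnitAddCircle))) :=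
    IsOpenMap.piMap (fun _ => QuotientAddGroup.isOpenMap_coe) (by simp)
  exact this

theorem UnitAddCircle.coe_eq_zero_iff_int {t : ℝ} :
    (t : UnitAddCircle) = 0 ↔ ∃ m : ℤ, t = m := by
  rw [AddCircle.coe_eq_zero_iff]
  simp [eq_comm]

theorem torusMk_intVec (z : Fin n → ℤ) : torusMk n (intVec z) = 0 :=
  funext fun i => UnitAddCircle.coe_eq_zero_iff_int.2 ⟨z i, rfl⟩

theorem torusMk_eq_iff {x y : Fin n → ℝ} :
    torusMk n x = torusMk n y ↔ ∃ z : Fin n → ℤ, y = x + intVec z := by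
  constructor
  · intro h
    have h0 : torusMk n (y - x) = 0 := by rw [map_sub, h, sub_self]
    choose z hz using fun i => UnitAddCircle.coe_eq_zero_iff_int.1 (congrFun h0 i)
    refine ⟨z, ?_⟩
    rw [← sub_eq_iff_eq_add']
    exact funext hz
  · rintro ⟨z, rfl⟩
    rw [map_add, torusMk_intVec, add_zero]

/-- A continuous homomorphism from the torus to the circle lifts to a linear functional. -/
theorem exists_linear_lift (θ : UnitAddTorus (Fin n) →+ UnitAddCircle) (hθ : Continuous θ) :
    ∃ L : (Fin n → ℝ) →ₗ[ℝ] ℝ, ∀ x, ((L x : ℝ) : UnitAddCircle) = θ (torusMk n x) := by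
  have cov := AddCircle.isCoveringMap_coe (1 : ℝ)
  obtain ⟨F, ⟨hF0, hF⟩, -⟩ := cov.existsUnique_continuousMap_lifts
    (⟨fun x => θ (torusMk n x), hθ.comp continuous_torusMk⟩ : C(Fin n → ℝ, UnitAddCircle)) 0 0
    (by simp)
  have hF' : ∀ x, ((F x : ℝ) : UnitAddCircle) = θ (torusMk n x) := fun x => congrFun hF x
  have hadd : ∀ x y, F (x + y) = F x + F y := by
    intro x y
    -- Both sides lift the same map on the connected space `ℝⁿ × ℝⁿ` and agree at `0`, so uniqueness
    -- of lifts gives additivity.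
    have := cov.eq_of_comp_eq (g₁ := fun p : (Fin n → ℝ) × (Fin n → ℝ) => F (p.1 + p.2))
      (g₂ := fun p => F p.1 + F p.2) (by fun_prop) (by fun_prop)
      (funext fun p => by simp [hF']) 0 (by simp [hF0])
    exact congrFun this (x, y)
  let G : (Fin n → ℝ) →+ ℝ := ⟨⟨F, hF0⟩, hadd⟩
  exact ⟨(G.toRealLinearMap F.continuous).toLinearMap, hF'⟩

/-- A hyperplane of the torus lifts to a periodic family of parallel hyperplanes. -/
theorem IsToricHyperplane.exists_lift {H : Set (UnitAddTorus (Fin n))} (hH : IsToricHyperplane H) :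
    ∃ (L : (Fin n → ℝ) →ₗ[ℝ] ℝ) (b : ℝ),
      (∀ x, torusMk n x ∈ H ↔ ∃ m : ℤ, L x - b = m) ∧
        ∀ z : Fin n → ℤ, ∃ m : ℤ, L (intVec z) = m := by
  obtain ⟨θ, b, hθ, -, rfl⟩ := hH
  obtain ⟨L, hL⟩ := exists_linear_lift θ hθ
  obtain ⟨b, rfl⟩ := QuotientAddGroup.mk_surjective b
  refine ⟨L, b, fun x => ?_, fun z => ?_⟩
  · rw [← UnitAddCircle.coe_eq_zero_iff_int, AddCircle.coe_sub, sub_eq_zero, hL]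
    rfl
  · rw [← UnitAddCircle.coe_eq_zero_iff_int, hL, torusMk_intVec, map_zero]

theorem edist_torusMk_of_norm_sub_le {x y : Fin n → ℝ} (h : ‖x - y‖ ≤ 1 / 2) :
    edist (torusMk n x) (torusMk n y) = edist x y := by
  rw [edist_pi_def, edist_pi_def]
  congr 1
  funext i
  have hi : |x i - y i| ≤ 1 / 2 := (norm_le_pi_norm (x - y) i).trans h
  rw [edist_dist, edist_dist, torusMk_apply, torusMk_apply, dist_eq_norm, ← AddCircle.coe_sub,
    (AddCircle.norm_coe_eq_abs_iff (p := (1 : ℝ)) one_ne_zero).2 (by simpa using hi),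
    Real.dist_eq]

/-- A subset of the torus containing the image of an affine subspace has at least the
dimension of that subspace. -/
theorem finrank_le_dimH (K : Submodule ℝ (Fin n → ℝ)) (x : Fin n → ℝ)
    (F : Set (UnitAddTorus (Fin n))) (hF : ∀ u ∈ K, torusMk n (x + u) ∈ F) :
    (Module.finrank ℝ K : ℝ≥0∞) ≤ dimH F := by
  -- Two points of a ball of radius `1/4` differ by at most `1/2`, the range in which the projection
  -- preserves distances.
  let U : Set K := Metric.ball 0 (1 / 4)
  let f : U → UnitAddTorus (Fin n) := fun u => torusMk n (x + u)
  have hf : Isometry f := by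
    intro u v
    have hu : ‖((u : K) : Fin n → ℝ)‖ < 1 / 4 := by simpa [U] using u.2
    have hv : ‖((v : K) : Fin n → ℝ)‖ < 1 / 4 := by simpa [U] using v.2
    have h : ‖(x + (u : K)) - (x + ((v : K) : Fin n → ℝ))‖ ≤ 1 / 2 := by
      rw [add_sub_add_left_eq_sub]
      exact (norm_sub_le _ _).trans (by linarith)
    rw [edist_torusMk_of_norm_sub_le h, edist_add_left]
    rfl
  have hU : dimH U = Module.finrank ℝ K := Real.dimH_of_mem_nhds (Metric.ball_mem_nhds 0 (by norm_num))
  rw [← hU]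
  have h1 : dimH (univ : Set U) = dimH U := by
    have := (isometry_subtype_coe (s := U)).dimH_image univ
    rw [← this, image_univ, Subtype.range_coe]
  rw [← h1, ← hf.dimH_image]
  refine dimH_mono ?_
  rintro _ ⟨u, -, rfl⟩
  exact hF _ (u : K).2

end Torus

/-! ### Periodic arrangements in `ℝⁿ`. -/

open Filter Topology in
theorem eventually_add_mul_lt {a c d : ℝ} (h : a < d) : ∀ᶠ t in 𝓝[>] (0 : ℝ), a + t * c < d := by
  have : Tendsto (fun t : ℝ => a + t * c) (𝓝[>] 0) (𝓝 (a + 0 * c)) :=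
    tendsto_nhdsWithin_of_tendsto_nhds (Continuous.tendsto (by fun_prop) 0)
  rw [zero_mul, add_zero] at this
  exact this.eventually_lt_const h

open Filter Topology in
theorem eventually_lt_add_mul {a c d : ℝ} (h : d < a) : ∀ᶠ t in 𝓝[>] (0 : ℝ), d < a + t * c := by
  filter_upwards [eventually_add_mul_lt (c := -c) (neg_lt_neg h)] with t ht
  linarith

/-- A finite family of affine functionals on `ℝⁿ`, with linear parts integral on `ℤⁿ`. It represents
the `ℤⁿ`-periodic arrangement of the hyperplanes where one of the functionals is an integer. -/
structure PeriodicArrangement (n : ℕ) (ι : Type*) where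
  linear : ι → (Fin n → ℝ) →ₗ[ℝ] ℝ
  offset : ι → ℝ
  integral : ∀ i z, ∃ m : ℤ, linear i (intVec z) = m

namespace PeriodicArrangement

variable {n : ℕ} {ι : Type*} (P : PeriodicArrangement n ι)

/-- The value of the `i`-th affine functional. -/
def value (i : ι) (x : Fin n → ℝ) : ℝ := P.linear i x - P.offset i

open Classical in
/-- The functionals which are integral at a point. -/
def inc [Fintype ι] (x : Fin n → ℝ) : Finset ι := {i | ∃ m : ℤ, P.value i x = m}

/-- The common kernel of the linear parts of some of the functionals. -/
def ker (S : Finset ι) : Submodule ℝ (Fin n → ℝ) := ⨅ i ∈ S, (P.linear i).ker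

/-- Floors and ceilings of all functionals at a point. -/
def code (x : Fin n → ℝ) (i : ι) : ℤ × ℤ := (⌊P.value i x⌋, ⌈P.value i x⌉)

/-- The closed cell of a point. -/
def closedCell (x : Fin n → ℝ) : Set (Fin n → ℝ) :=
  {w | ∀ i, ((P.code x i).1 : ℝ) ≤ P.value i w ∧ P.value i w ≤ (P.code x i).2}

/-- The relatively open cell of a point. -/
def cell (x : Fin n → ℝ) : Set (Fin n → ℝ) := {w | P.code w = P.code x}

/-- Any point is on as many hyperplanes as the codimension of their intersection. -/
def IsSimple [Fintype ι] : Prop := ∀ x, Module.finrank ℝ (P.ker (P.inc x)) + (P.inc x).card ≤ n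

/-- A functional vanishing on no positive-dimensional intersection of hyperplanes. -/
def IsGeneric (l : (Fin n → ℝ) →ₗ[ℝ] ℝ) : Prop :=
  ∀ S : Finset ι, P.ker S ≠ ⊥ → ∃ u ∈ P.ker S, l u ≠ 0

/-- `v` is the lowest point of the closed cell of `x`, with respect to the height `l`. -/
def IsBottom (l : (Fin n → ℝ) →ₗ[ℝ] ℝ) (x v : Fin n → ℝ) : Prop :=
  v ∈ P.closedCell x ∧ ∀ w ∈ P.closedCell x, l v ≤ l w

variable {P}

theorem mem_ker {S : Finset ι} {u : Fin n → ℝ} : u ∈ P.ker S ↔ ∀ i ∈ S, P.linear i u = 0 := by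
  simp [ker]

theorem value_add (i : ι) (x u : Fin n → ℝ) : P.value i (x + u) = P.value i x + P.linear i u := by
  simp [value]; ring

theorem value_add_smul (i : ι) (x u : Fin n → ℝ) (t : ℝ) :
    P.value i (x + t • u) = P.value i x + t * P.linear i u := by
  simp [value_add]

theorem linear_sub (i : ι) (x w : Fin n → ℝ) :
    P.linear i (x - w) = P.value i x - P.value i w := by
  simp [value]

theorem code_eq_of_mem_Ioo {x : Fin n → ℝ} {i : ι} {m : ℤ} (h1 : (m : ℝ) < P.value i x)
    (h2 : P.value i x < (m : ℝ) + 1) : P.code x i = (m, m + 1) := by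
  refine Prod.ext (Int.floor_eq_iff.2 ⟨h1.le, h2⟩) (Int.ceil_eq_iff.2 ?_)
  push_cast
  constructor <;> linarith

theorem mem_closedCell_self (x : Fin n → ℝ) : x ∈ P.closedCell x :=
  fun _ => ⟨Int.floor_le _, Int.le_ceil _⟩

/-- Floor and ceiling are monotone, so prescribing both for one functional cuts out the linear
preimage of an order-convex set of reals. -/
theorem convex_cell (x : Fin n → ℝ) : Convex ℝ (P.cell x) := by
  have : P.cell x = ⋂ i, P.linear i ⁻¹'
      {y | (⌊y - P.offset i⌋, ⌈y - P.offset i⌉) = P.code x i} := by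
    ext w
    simp only [cell, code, mem_ofPred_eq, funext_iff, mem_iInter, mem_preimage, value]
  rw [this]
  refine convex_iInter fun i => Convex.linear_preimage (Set.OrdConnected.convex ?_) (P.linear i)
  refine ⟨fun a ha c hc y hy => ?_⟩
  rw [mem_ofPred_eq, Prod.ext_iff] at ha hc ⊢
  have h1 : a - P.offset i ≤ y - P.offset i := sub_le_sub_right hy.1 _
  have h2 : y - P.offset i ≤ c - P.offset i := sub_le_sub_right hy.2 _
  exact ⟨le_antisymm ((Int.floor_mono h2).trans hc.1.le) (ha.1.ge.trans (Int.floor_mono h1)),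
    le_antisymm ((Int.ceil_mono h2).trans hc.2.le) (ha.2.ge.trans (Int.ceil_mono h1))⟩

theorem continuous_value (i : ι) : Continuous (P.value i) :=
  (P.linear i).continuous_of_finiteDimensional.sub continuous_const

theorem code_add_intVec (i : ι) (z : Fin n → ℤ) :
    ∃ m : ℤ, (P.linear i (intVec z) = m) ∧
      ∀ x, P.code (x + intVec z) i = P.code x i + (m, m) := by
  obtain ⟨m, hm⟩ := P.integral i z
  refine ⟨m, hm, fun x => ?_⟩
  simp [code, value_add, hm]

theorem IsBottom.congr {l : (Fin n → ℝ) →ₗ[ℝ] ℝ} {x x' v : Fin n → ℝ} (h : P.IsBottom l x v)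
    (hx : P.code x = P.code x') : P.IsBottom l x' v := by
  unfold IsBottom closedCell at *
  rwa [hx] at h

theorem code_add_intVec_inj {x w : Fin n → ℝ} (z : Fin n → ℤ) :
    P.code (x + intVec z) = P.code (w + intVec z) ↔ P.code x = P.code w := by
  rw [funext_iff, funext_iff]
  refine forall_congr' fun i => ?_
  obtain ⟨m, -, hm⟩ := P.code_add_intVec i z
  rw [hm, hm, add_left_inj]

theorem add_intVec_mem_closedCell {x w : Fin n → ℝ} (z : Fin n → ℤ) :
    w + intVec z ∈ P.closedCell (x + intVec z) ↔ w ∈ P.closedCell x := by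
  refine forall_congr' fun i => ?_
  obtain ⟨m, h1, h2⟩ := P.code_add_intVec i z
  simp [h2, value_add, h1]

theorem finrank_range_add (S : Finset ι) :
    Module.finrank ℝ (LinearMap.pi fun i : S => P.linear i).range +
      Module.finrank ℝ (P.ker S) = n := by
  have := LinearMap.finrank_range_add_finrank_ker (LinearMap.pi fun i : S => P.linear i)
  rw [Module.finrank_fin_fun] at this
  have hker : P.ker S = (LinearMap.pi fun i : S => P.linear i).ker := by
    ext u
    simp [mem_ker, funext_iff]
  rwa [hker]

theorem IsBottom.add_intVec {l : (Fin n → ℝ) →ₗ[ℝ] ℝ} {x v : Fin n → ℝ} (h : P.IsBottom l x v)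
    (z : Fin n → ℤ) : P.IsBottom l (x + intVec z) (v + intVec z) := by
  refine ⟨(add_intVec_mem_closedCell z).2 h.1, fun w hw => ?_⟩
  obtain ⟨w, rfl⟩ : ∃ w', w = w' + intVec z := ⟨w - intVec z, by simp⟩
  have := h.2 w ((add_intVec_mem_closedCell z).1 hw)
  simpa using this

variable [Fintype ι]

theorem mem_inc {x : Fin n → ℝ} {i : ι} : i ∈ P.inc x ↔ ∃ m : ℤ, P.value i x = m := by
  simp [inc]

theorem mem_inc_iff_floor_eq_ceil {x : Fin n → ℝ} {i : ι} :
    i ∈ P.inc x ↔ (P.code x i).1 = (P.code x i).2 := by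
  rw [mem_inc]
  constructor
  · rintro ⟨m, hm⟩
    simp [code, hm]
  · intro h
    refine ⟨⌊P.value i x⌋, le_antisymm ?_ (Int.floor_le _)⟩
    have := Int.le_ceil (P.value i x)
    simp only [code] at h
    rwa [← h] at this

theorem code_of_notMem_inc {x : Fin n → ℝ} {i : ι} (h : i ∉ P.inc x) :
    ((P.code x i).1 : ℝ) < P.value i x ∧ P.value i x < (P.code x i).2 :=
  ⟨(Int.floor_le _).lt_of_ne fun h' => h (mem_inc.2 ⟨_, h'.symm⟩),
    (Int.le_ceil _).lt_of_ne fun h' => h (mem_inc.2 ⟨_, h'⟩)⟩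

theorem ceil_eq_floor_add_one {x : Fin n → ℝ} {i : ι} (h : i ∉ P.inc x) :
    (P.code x i).2 = (P.code x i).1 + 1 := by
  have h1 := code_of_notMem_inc h
  refine le_antisymm (Int.ceil_le_floor_add_one _) ?_
  have : ((P.code x i).1 : ℝ) < (P.code x i).2 := h1.1.trans h1.2
  exact_mod_cast this

theorem code_of_mem_inc {x : Fin n → ℝ} {i : ι} (h : i ∈ P.inc x) :
    ((P.code x i).1 : ℝ) = P.value i x ∧ ((P.code x i).2 : ℝ) = P.value i x := by
  obtain ⟨m, hm⟩ := mem_inc.1 h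
  simp [code, hm]

theorem inc_eq_of_code_eq {x w : Fin n → ℝ} (h : P.code x = P.code w) : P.inc x = P.inc w := by
  ext i
  rw [mem_inc_iff_floor_eq_ceil, mem_inc_iff_floor_eq_ceil, h]

theorem value_eq_of_mem_inc {x w : Fin n → ℝ} {i : ι} (hi : i ∈ P.inc x)
    (hw : w ∈ P.closedCell x) : P.value i w = P.value i x := by
  have h1 := code_of_mem_inc hi
  have h2 := hw i
  rw [h1.1, h1.2] at h2
  exact le_antisymm h2.2 h2.1

theorem inc_subset {x w : Fin n → ℝ} (hw : w ∈ P.closedCell x) : P.inc x ⊆ P.inc w := by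
  intro i hi
  obtain ⟨m, hm⟩ := mem_inc.1 hi
  exact mem_inc.2 ⟨m, (value_eq_of_mem_inc hi hw).trans hm⟩

theorem code_eq_of_notMem_inc {x v : Fin n → ℝ} (hv : v ∈ P.closedCell x) {i : ι}
    (hi : i ∉ P.inc v) : P.code v i = P.code x i := by
  have hx : i ∉ P.inc x := fun h => hi (inc_subset hv h)
  have hx' := ceil_eq_floor_add_one hx
  have h := hv i
  have h1 : ((P.code x i).1 : ℝ) < P.value i v :=
    h.1.lt_of_ne fun h' => hi (mem_inc.2 ⟨_, h'.symm⟩)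
  have h2 : P.value i v < (P.code x i).1 + 1 := by
    have := h.2.lt_of_ne fun h' => hi (mem_inc.2 ⟨_, h'⟩)
    rw [hx'] at this
    exact_mod_cast this
  rw [code_eq_of_mem_Ioo h1 h2, ← hx']

/-! ### Cells -/

/-- A cell is relatively open in the points on the same hyperplanes. -/
theorem exists_isOpen_inter_eq_cell (x : Fin n → ℝ) :
    ∃ U, IsOpen U ∧ P.cell x = U ∩ {w | P.inc w = P.inc x} := by
  -- For a non-incident functional this interval is the open slab between consecutive integers; for
  -- an incident one it is the unit neighbourhood of an integer, which contains no other integer.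
  refine ⟨⋂ i, P.value i ⁻¹' Ioo ((P.code x i).2 - 1) ((P.code x i).1 + 1),
    isOpen_iInter_of_finite fun i => isOpen_Ioo.preimage (continuous_value i), ?_⟩
  ext w
  constructor
  · intro hw
    refine ⟨mem_iInter.2 fun i => ?_, inc_eq_of_code_eq hw⟩
    rw [← show P.code w = P.code x from hw]
    exact ⟨sub_lt_iff_lt_add.2 (Int.ceil_lt_add_one _), Int.lt_floor_add_one _⟩
  · rintro ⟨hU, hinc⟩
    funext i
    obtain ⟨h1, h2⟩ := mem_iInter.1 hU i
    by_cases hi : i ∈ P.inc x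
    · obtain ⟨m, hm⟩ := mem_inc.1 hi
      obtain ⟨m', hm'⟩ := mem_inc.1 (show i ∈ P.inc w from hinc ▸ hi)
      rw [(code_of_mem_inc hi).2, hm, hm'] at h1
      rw [(code_of_mem_inc hi).1, hm, hm'] at h2
      have h1 : m - 1 < m' := by exact_mod_cast h1
      have h2 : m' < m + 1 := by exact_mod_cast h2
      have : m' = m := by omega
      simp [code, hm, hm', this]
    · have c := ceil_eq_floor_add_one hi
      rw [c] at h1
      push_cast at h1
      rw [code_eq_of_mem_Ioo (by linarith) h2, ← c]

theorem finite_code_image {K : Set (Fin n → ℝ)} (hK : IsCompact K) : (P.code '' K).Finite := by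
  have hb : ∀ i, ∃ M : ℤ, ∀ x ∈ K, |P.value i x| ≤ M := by
    intro i
    obtain ⟨C, hC⟩ := hK.exists_bound_of_continuousOn (continuous_value (P := P) i).continuousOn
    exact ⟨⌈C⌉, fun x hx => (hC x hx).trans (Int.le_ceil C)⟩
  choose M hM using hb
  refine (Set.Finite.pi (t := fun i => (Icc (-M i) (M i)) ×ˢ (Icc (-M i) (M i)))
    fun i => (finite_Icc _ _).prod (finite_Icc _ _)).subset ?_
  rintro _ ⟨x, hx, rfl⟩ i -
  have h := abs_le.1 (hM i x hx)
  have h' : ((-M i : ℤ) : ℝ) ≤ P.value i x := by push_cast; exact h.1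
  exact ⟨⟨Int.le_floor.2 h', by exact_mod_cast (Int.floor_le _).trans h.2⟩,
    ⟨by exact_mod_cast h'.trans (Int.le_ceil _), Int.ceil_le.2 h.2⟩⟩

/-! ### Translations by the lattice -/

theorem inc_add_intVec (x : Fin n → ℝ) (z : Fin n → ℤ) : P.inc (x + intVec z) = P.inc x := by
  ext i
  obtain ⟨m, -, hm⟩ := P.code_add_intVec i z
  rw [mem_inc_iff_floor_eq_ceil, mem_inc_iff_floor_eq_ceil, hm]
  simp

/-! ### Linear algebra -/

theorem le_card_of_ker_eq_bot {S : Finset ι} (h : P.ker S = ⊥) : n ≤ S.card := by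
  have h1 := P.finrank_range_add S
  have h2 := Submodule.finrank_le (LinearMap.pi fun i : S => P.linear i).range
  rw [h, finrank_bot] at h1
  rw [Module.finrank_fintype_fun_eq_card, Fintype.card_coe] at h2
  omega

theorem IsSimple.ker_eq_bot (hP : P.IsSimple) {x : Fin n → ℝ} (h : (P.inc x).card = n) :
    P.ker (P.inc x) = ⊥ := by
  have := hP x
  rw [← Submodule.finrank_eq_zero (R := ℝ)]
  omega

-- By rank-nullity, simplicity makes the linear parts of the incident functionals jointly
-- surjective; the `e i` are preimages of the standard basis vectors.
open Classical in
theorem IsSimple.exists_dual (hP : P.IsSimple) (x : Fin n → ℝ) :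
    ∃ e : ι → Fin n → ℝ, ∀ i ∈ P.inc x, ∀ j ∈ P.inc x,
      P.linear j (e i) = if j = i then 1 else 0 := by
  have h1 := P.finrank_range_add (P.inc x)
  have h2 := hP x
  have h3 := Submodule.finrank_le (LinearMap.pi fun i : P.inc x => P.linear i).range
  have h4 : (LinearMap.pi fun i : P.inc x => P.linear i).range = ⊤ := by
    apply Submodule.eq_top_of_finrank_eq
    rw [Module.finrank_fintype_fun_eq_card, Fintype.card_coe] at h3 ⊢
    omega
  rw [LinearMap.range_eq_top] at h4
  choose e he using fun i : ι => h4 fun j => if (j : ι) = i then 1 else 0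
  exact ⟨e, fun i _ j hj => congrFun (he i) ⟨j, hj⟩⟩

/-- The functionals to avoid form the annihilators of the nonzero `P.ker S`, finitely many proper
subspaces of the dual, and these cannot cover it. -/
theorem exists_isGeneric (P : PeriodicArrangement n ι) : ∃ l, P.IsGeneric l := by
  have h := Subspace.biUnion_ne_univ_of_top_notMem (k := ℝ)
    (s := (Finset.univ.image fun S : {S : Finset ι // P.ker S ≠ ⊥} =>
      (P.ker S).dualAnnihilator : Finset (Subspace ℝ (Module.Dual ℝ (Fin n → ℝ))))) ?_
  · obtain ⟨l, hl⟩ := (Set.ne_univ_iff_exists_notMem _).1 h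
    refine ⟨l, fun S hS => ?_⟩
    by_contra! hu
    refine hl (mem_biUnion (x := (P.ker S).dualAnnihilator) ?_ ?_)
    · simp only [Finset.coe_image, Finset.coe_univ, image_univ, mem_range]
      exact ⟨⟨S, hS⟩, rfl⟩
    · exact (Submodule.mem_dualAnnihilator l).2 hu
  · simp only [Finset.mem_image, Finset.mem_univ, true_and, not_exists]
    rintro ⟨S, hS⟩ h
    refine hS ?_
    rwa [← Submodule.dualAnnihilator_bot, Subspace.dualAnnihilator_inj] at h

/-! ### Lowest points -/

open Filter Topology in
/-- One can move inside a closed cell in any direction not violating a tight constraint. -/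
theorem eventually_mem_closedCell {x v u : Fin n → ℝ} (hv : v ∈ P.closedCell x)
    (h1 : ∀ i, 0 < P.linear i u → P.value i v < (P.code x i).2)
    (h2 : ∀ i, P.linear i u < 0 → (P.code x i).1 < P.value i v) :
    ∀ᶠ t in 𝓝[>] (0 : ℝ), v + t • u ∈ P.closedCell x := by
  refine eventually_all.2 fun i => ?_
  simp only [value_add_smul]
  have hv := hv i
  refine Filter.Eventually.and ?_ ?_
  · rcases lt_or_ge (P.linear i u) 0 with h | h
    · exact (eventually_lt_add_mul (h2 i h)).mono fun t ht => ht.le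
    · filter_upwards [self_mem_nhdsWithin] with t ht
      have := mul_nonneg (le_of_lt (show (0 : ℝ) < t from ht)) h
      linarith
  · rcases lt_or_ge 0 (P.linear i u) with h | h
    · exact (eventually_add_mul_lt (h1 i h)).mono fun t ht => ht.le
    · filter_upwards [self_mem_nhdsWithin] with t ht
      have := mul_nonneg (le_of_lt (show (0 : ℝ) < t from ht)) (neg_nonneg.2 h)
      linarith

variable {l : (Fin n → ℝ) →ₗ[ℝ] ℝ}

/-- There is no descent direction at the lowest point. -/
theorem IsBottom.nonneg {x v u : Fin n → ℝ} (hv : P.IsBottom l x v)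
    (h1 : ∀ i ∈ P.inc v, 0 < P.linear i u → P.value i v < (P.code x i).2)
    (h2 : ∀ i ∈ P.inc v, P.linear i u < 0 → (P.code x i).1 < P.value i v) : 0 ≤ l u := by
  have h := eventually_mem_closedCell (u := u) hv.1 (fun i hi => ?_) (fun i hi => ?_)
  · obtain ⟨t, ht, ht0⟩ := (h.and self_mem_nhdsWithin).exists
    have := hv.2 _ ht
    rw [map_add, map_smul, smul_eq_mul, le_add_iff_nonneg_right] at this
    exact nonneg_of_mul_nonneg_right this ht0
  · by_cases hi' : i ∈ P.inc v
    · exact h1 i hi' hi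
    · exact (hv.1 i).2.lt_of_ne fun h' => hi' (mem_inc.2 ⟨_, h'⟩)
  · by_cases hi' : i ∈ P.inc v
    · exact h2 i hi' hi
    · exact (hv.1 i).1.lt_of_ne fun h' => hi' (mem_inc.2 ⟨_, h'.symm⟩)

/-- For `u` in the kernel both `u` and `-u` are admissible directions at `v`, so `l u = 0`;
genericity forbids this on a nonzero kernel. -/
theorem IsBottom.ker_eq_bot (hl : P.IsGeneric l) {x v : Fin n → ℝ} (hv : P.IsBottom l x v) :
    P.ker (P.inc v) = ⊥ := by
  by_contra h
  obtain ⟨u, hu, hlu⟩ := hl _ h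
  rw [mem_ker] at hu
  have key : ∀ u, (∀ i ∈ P.inc v, P.linear i u = 0) → 0 ≤ l u := fun u hu =>
    hv.nonneg (fun i hi h => by simp [hu i hi] at h) (fun i hi h => by simp [hu i hi] at h)
  have h1 := key u hu
  have h2 := key (-u) fun i hi => by rw [map_neg, hu i hi, neg_zero]
  rw [map_neg] at h2
  exact hlu (by linarith)

theorem IsBottom.card_inc (hP : P.IsSimple) (hl : P.IsGeneric l) {x v : Fin n → ℝ}
    (hv : P.IsBottom l x v) : (P.inc v).card = n := by
  have h1 := le_card_of_ker_eq_bot (hv.ker_eq_bot hl)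
  have h2 := hP v
  omega

/-- A basis of `ℝⁿ` dual to the hyperplanes through a vertex; the height is not constant on any of
the lines of the arrangement through the vertex. -/
theorem exists_edges (hP : P.IsSimple) (hl : P.IsGeneric l) {v : Fin n → ℝ}
    (hv : (P.inc v).card = n) : ∃ e : ι → Fin n → ℝ,
      (∀ i ∈ P.inc v, P.linear i (e i) = 1) ∧
      (∀ i ∈ P.inc v, ∀ j ∈ P.inc v, j ≠ i → P.linear j (e i) = 0) ∧
      (∀ i ∈ P.inc v, l (e i) ≠ 0) ∧
      ∀ w, w = ∑ i ∈ P.inc v, P.linear i w • e i := by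
  classical
  obtain ⟨e, he⟩ := hP.exists_dual v
  have hker := hP.ker_eq_bot hv
  have hsum : ∀ w, w = ∑ i ∈ P.inc v, P.linear i w • e i := by
    intro w
    rw [← sub_eq_zero, ← Submodule.mem_bot ℝ, ← hker, mem_ker]
    intro j hj
    rw [map_sub, map_sum, Finset.sum_congr rfl fun i hi => by
      rw [map_smul, he i hi j hj, smul_eq_mul, mul_ite, mul_one, mul_zero]]
    simp [hj]
  refine ⟨e, fun i hi => by simp [he i hi i hi], fun i hi j hj hij => by simp [he i hi j hj, hij],
    fun i hi h => ?_, hsum⟩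
  -- The remaining `n - 1` functionals vanish on a common line, spanned by `e i`; genericity is
  -- applied to that line.
  have hne : P.ker ((P.inc v).erase i) ≠ ⊥ := fun hb => by
    have := le_card_of_ker_eq_bot hb
    have := Finset.card_erase_lt_of_mem hi
    omega
  obtain ⟨u, hu, hlu⟩ := hl _ hne
  rw [mem_ker] at hu
  apply hlu
  rw [hsum u, Finset.sum_eq_single i, map_smul, h, smul_zero]
  · intro j hj hji
    rw [hu j (Finset.mem_erase.2 ⟨hji, hj⟩), zero_smul]
  · exact fun h => absurd hi h

/-- The `n` independent functionals at `x₀` embed `ℝⁿ` as a closed subspace in which the closed cell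
is bounded, hence compact. This is what spanning is for. -/
theorem exists_isBottom (hP : P.IsSimple) {x₀ : Fin n → ℝ} (h₀ : (P.inc x₀).card = n)
    (l : (Fin n → ℝ) →ₗ[ℝ] ℝ) (x : Fin n → ℝ) : ∃ v, P.IsBottom l x v := by
  have hker := hP.ker_eq_bot h₀
  have hemb : Topology.IsClosedEmbedding (LinearMap.pi fun i : P.inc x₀ => P.linear i) := by
    refine LinearMap.isClosedEmbedding_of_injective (𝕜 := ℝ) ?_
    rw [← hker]
    ext u
    simp [mem_ker, funext_iff]
  have hclosed : IsClosed (P.closedCell x) := by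
    simp only [closedCell, ofPred_forall]
    exact isClosed_iInter fun i => (isClosed_le continuous_const (continuous_value i)).inter
      (isClosed_le (continuous_value i) continuous_const)
  have hcpt : IsCompact (P.closedCell x) := by
    refine (hemb.isCompact_preimage (isCompact_Icc
      (a := fun i : P.inc x₀ => ((P.code x i).1 : ℝ) + P.offset i)
      (b := fun i => ((P.code x i).2 : ℝ) + P.offset i))).of_isClosed_subset hclosed ?_
    intro w hw
    refine ⟨fun i => ?_, fun i => ?_⟩
    · have := (hw i).1
      simp only [value] at this
      simp only [LinearMap.pi_apply]
      linarith
    · have := (hw i).2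
      simp only [value] at this
      simp only [LinearMap.pi_apply]
      linarith
  obtain ⟨v, hv, hmin⟩ := hcpt.exists_isMinOn ⟨x, mem_closedCell_self x⟩
    (l.continuous_of_finiteDimensional.continuousOn)
  exact ⟨v, hv, fun w hw => hmin hw⟩

/-- Were the lower bound not attained, `-u` would be an admissible direction of descent. The next
lemma is the mirror image with `u`. -/
theorem IsBottom.value_eq_floor {x v u : Fin n → ℝ} {i : ι} (hv : P.IsBottom l x v)
    (h1 : P.linear i u = 1) (h0 : ∀ j ∈ P.inc v, j ≠ i → P.linear j u = 0) (hlu : 0 < l u) :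
    P.value i v = (P.code x i).1 := by
  by_contra hne
  have := hv.nonneg (u := -u) (fun j hj h => ?_) (fun j hj h => ?_)
  · rw [map_neg] at this
    linarith
  all_goals
    rcases eq_or_ne j i with rfl | hji
    · rw [map_neg, h1] at h
      first | (norm_num at h; done) | exact (hv.1 j).1.lt_of_ne (Ne.symm hne)
    · simp [h0 j hj hji] at h

theorem IsBottom.value_eq_ceil {x v u : Fin n → ℝ} {i : ι} (hv : P.IsBottom l x v)
    (h1 : P.linear i u = 1) (h0 : ∀ j ∈ P.inc v, j ≠ i → P.linear j u = 0) (hlu : l u < 0) :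
    P.value i v = (P.code x i).2 := by
  by_contra hne
  have := hv.nonneg (u := u) (fun j hj h => ?_) (fun j hj h => ?_)
  · linarith
  all_goals
    rcases eq_or_ne j i with rfl | hji
    · rw [h1] at h
      first | (norm_num at h; done) | exact (hv.1 j).2.lt_of_ne hne
    · simp [h0 j hj hji] at h

/-- Sign criterion for uniqueness of the lowest point. -/
theorem eq_of_le {x v w : Fin n → ℝ} {e : ι → Fin n → ℝ} (hv : v ∈ P.closedCell x)
    (hw : w ∈ P.closedCell x)
    (hle : ∀ i ∈ P.inc v, l (e i) ≠ 0) (hsum : ∀ w, w = ∑ i ∈ P.inc v, P.linear i w • e i)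
    (hpos : ∀ i ∈ P.inc v, i ∉ P.inc x → 0 < l (e i) → P.value i v = (P.code x i).1)
    (hneg : ∀ i ∈ P.inc v, i ∉ P.inc x → l (e i) < 0 → P.value i v = (P.code x i).2) :
    l v ≤ l w ∧ (l w = l v → w = v) := by
  -- Expanding `w - v` in the basis `e` turns `l w - l v` into a sum of these terms; in each, the
  -- two factors never have opposite signs.
  have hterm : ∀ i ∈ P.inc v, 0 ≤ P.linear i (w - v) * l (e i) := by
    intro i hi
    rw [linear_sub]
    by_cases hix : i ∈ P.inc x
    · rw [value_eq_of_mem_inc hix hv, value_eq_of_mem_inc hix hw, sub_self, zero_mul]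
    · rcases (hle i hi).lt_or_gt with h | h
      · rw [hneg i hi hix h]
        exact mul_nonneg_of_nonpos_of_nonpos (sub_nonpos.2 (hw i).2) h.le
      · rw [hpos i hi hix h]
        exact mul_nonneg (sub_nonneg.2 (hw i).1) h.le
  have heq : l w - l v = ∑ i ∈ P.inc v, P.linear i (w - v) * l (e i) := by
    rw [← map_sub]
    conv_lhs => rw [hsum (w - v)]
    simp
  refine ⟨sub_nonneg.1 (heq ▸ Finset.sum_nonneg hterm), fun h => ?_⟩
  rw [h, sub_self, eq_comm, Finset.sum_eq_zero_iff_of_nonneg hterm] at heq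
  rw [← sub_eq_zero, hsum (w - v)]
  refine Finset.sum_eq_zero fun i hi => ?_
  rw [(mul_eq_zero.1 (heq i hi)).resolve_right (hle i hi), zero_smul]

theorem IsBottom.unique (hP : P.IsSimple) (hl : P.IsGeneric l) {x v w : Fin n → ℝ}
    (hv : P.IsBottom l x v) (hw : P.IsBottom l x w) : w = v := by
  obtain ⟨e, h1, h0, hle, hsum⟩ := exists_edges hP hl (hv.card_inc hP hl)
  exact (eq_of_le hv.1 hw.1 hle hsum
    (fun i hi _ h => hv.value_eq_floor (h1 i hi) (h0 i hi) h)
    (fun i hi _ h => hv.value_eq_ceil (h1 i hi) (h0 i hi) h)).2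
      (le_antisymm (hw.2 v hv.1) (hv.2 w hw.1))

/-- A cell is determined by its lowest point and the hyperplanes containing it. -/
theorem IsBottom.code_eq (hP : P.IsSimple) (hl : P.IsGeneric l) {x x' v : Fin n → ℝ}
    (hv : P.IsBottom l x v) (hv' : P.IsBottom l x' v) (hinc : P.inc x = P.inc x') :
    P.code x = P.code x' := by
  obtain ⟨e, h1, h0, hle, -⟩ := exists_edges hP hl (hv.card_inc hP hl)
  funext i
  by_cases hi : i ∈ P.inc v
  · by_cases hix : i ∈ P.inc x
    · have hix' := hinc ▸ hix
      have a := code_of_mem_inc hix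
      have b := code_of_mem_inc hix'
      rw [← value_eq_of_mem_inc hix hv.1] at a
      rw [← value_eq_of_mem_inc hix' hv'.1] at b
      exact Prod.ext (by exact_mod_cast a.1.trans b.1.symm) (by exact_mod_cast a.2.trans b.2.symm)
    · have c := ceil_eq_floor_add_one hix
      have c' := ceil_eq_floor_add_one (hinc ▸ hix)
      -- The sign of `l (e i)` decides on which side of hyperplane `i` a cell with lowest point `v`
      -- lies.
      rcases (hle i hi).lt_or_gt with h | h
      · have a := (hv.value_eq_ceil (h1 i hi) (h0 i hi) h).symm.trans
          (hv'.value_eq_ceil (h1 i hi) (h0 i hi) h)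
        have a : (P.code x i).2 = (P.code x' i).2 := by exact_mod_cast a
        exact Prod.ext (by omega) a
      · have a := (hv.value_eq_floor (h1 i hi) (h0 i hi) h).symm.trans
          (hv'.value_eq_floor (h1 i hi) (h0 i hi) h)
        have a : (P.code x i).1 = (P.code x' i).1 := by exact_mod_cast a
        exact Prod.ext a (by omega)
  · rw [← code_eq_of_notMem_inc hv.1 hi, code_eq_of_notMem_inc hv'.1 hi]

open Filter Topology in
/-- Every choice of hyperplanes through a vertex is realized by a cell above that vertex. -/
theorem exists_isBottom_of_subset (hP : P.IsSimple) (hl : P.IsGeneric l) {v : Fin n → ℝ}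
    (hv : (P.inc v).card = n) {T : Finset ι} (hT : T ⊆ P.inc v) :
    ∃ x, P.IsBottom l x v ∧ P.inc x = T := by
  classical
  obtain ⟨e, h1, h0, hle, hsum⟩ := exists_edges hP hl hv
  -- This direction stays on the hyperplanes in `T` and leaves each of the others towards its upper
  -- side for `l`; the cell sought is that of `v + t • u` for small `t`.
  set u : Fin n → ℝ := ∑ i ∈ P.inc v \ T, ((SignType.sign (l (e i)) : SignType) : ℝ) • e i with hu
  have hu_in : ∀ i ∈ P.inc v, i ∉ T → P.linear i u = SignType.sign (l (e i)) := by
    intro i hi hiT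
    rw [hu, map_sum, Finset.sum_eq_single i, map_smul, h1 i hi, smul_eq_mul, mul_one]
    · intro j hj hji
      rw [map_smul, h0 j (Finset.mem_sdiff.1 hj).1 i hi hji.symm, smul_zero]
    · exact fun h => absurd (Finset.mem_sdiff.2 ⟨hi, hiT⟩) h
  have hu_T : ∀ i ∈ T, P.linear i u = 0 := by
    intro i hi
    rw [hu, map_sum]
    refine Finset.sum_eq_zero fun j hj => ?_
    obtain ⟨hj, hjT⟩ := Finset.mem_sdiff.1 hj
    rw [map_smul, h0 j hj i (hT hi) (fun h => hjT (h ▸ hi)), smul_zero]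
  -- The bound `t < 1` confines the functionals of `P.inc v` outside `T` to a slab adjacent to their
  -- integer; the last condition keeps those not integral at `v` in their slab.
  have hev : ∀ᶠ t in 𝓝[>] (0 : ℝ), 0 < t ∧ t < 1 ∧ ∀ i, i ∉ P.inc v →
      (P.code v i).1 < P.value i v + t * P.linear i u ∧
        P.value i v + t * P.linear i u < (P.code v i).2 := by
    refine Filter.Eventually.and self_mem_nhdsWithin ((eventually_nhdsWithin_of_eventually_nhds
      (eventually_lt_nhds one_pos)).and (eventually_all.2 fun i => ?_))
    by_cases hi : i ∈ P.inc v
    · simp [hi]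
    · have := code_of_notMem_inc hi
      filter_upwards [eventually_lt_add_mul (c := P.linear i u) this.1,
        eventually_add_mul_lt (c := P.linear i u) this.2] with t a b _ using ⟨a, b⟩
  obtain ⟨t, ht0, ht1, ht⟩ := hev.exists
  have hval := fun i => P.value_add_smul i v u t
  have hout : ∀ i ∉ P.inc v, P.code (v + t • u) i = P.code v i := by
    intro i hi
    have c := ceil_eq_floor_add_one hi
    have := ht i hi
    rw [← hval, c] at this
    push_cast at this
    rw [code_eq_of_mem_Ioo this.1 this.2, ← c]
  have hinT : ∀ i ∈ T, P.value i (v + t • u) = P.value i v := by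
    intro i hi
    rw [hval, hu_T i hi, mul_zero, add_zero]
  have hpos : ∀ i ∈ P.inc v, i ∉ T → 0 < l (e i) → ∃ m : ℤ, P.value i v = m ∧
      P.code (v + t • u) i = (m, m + 1) := by
    intro i hi hiT h
    obtain ⟨m, hm⟩ := mem_inc.1 hi
    refine ⟨m, hm, code_eq_of_mem_Ioo ?_ ?_⟩ <;>
    · rw [hval, hu_in i hi hiT, sign_pos h, hm]
      simp [ht0, ht1]
  have hneg : ∀ i ∈ P.inc v, i ∉ T → l (e i) < 0 → ∃ m : ℤ, P.value i v = m ∧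
      P.code (v + t • u) i = (m - 1, m) := by
    intro i hi hiT h
    obtain ⟨m, hm⟩ := mem_inc.1 hi
    have hc := P.code_eq_of_mem_Ioo (x := v + t • u) (i := i) (m := m - 1) ?_ ?_
    · exact ⟨m, hm, by rw [hc, sub_add_cancel]⟩
    all_goals
      rw [hval, hu_in i hi hiT, sign_neg h, hm]
      push_cast
      simp only [SignType.coe_one, mul_neg, mul_one]
      linarith
  have hinc : P.inc (v + t • u) = T := by
    ext i
    by_cases hi : i ∈ P.inc v
    · by_cases hiT : i ∈ T
      · obtain ⟨m, hm⟩ := mem_inc.1 hi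
        simp only [hiT, iff_true]
        exact mem_inc.2 ⟨m, (hinT i hiT).trans hm⟩
      · simp only [hiT, iff_false, mem_inc_iff_floor_eq_ceil]
        rcases (hle i hi).lt_or_gt with h | h
        · obtain ⟨m, -, hm⟩ := hneg i hi hiT h
          simp [hm]
        · obtain ⟨m, -, hm⟩ := hpos i hi hiT h
          simp [hm]
    · have : i ∉ T := fun h => hi (hT h)
      simp only [this, iff_false]
      rw [mem_inc_iff_floor_eq_ceil] at hi ⊢
      rwa [hout]
      rwa [mem_inc_iff_floor_eq_ceil]
  have hmem : v ∈ P.closedCell (v + t • u) := by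
    intro i
    by_cases hi : i ∈ P.inc v
    · by_cases hiT : i ∈ T
      · rw [← hinT i hiT]
        exact mem_closedCell_self _ i
      · rcases (hle i hi).lt_or_gt with h | h
        · obtain ⟨m, hm, hc⟩ := hneg i hi hiT h
          simp [hm, hc]
        · obtain ⟨m, hm, hc⟩ := hpos i hi hiT h
          simp [hm, hc]
    · rw [hout i hi]
      exact mem_closedCell_self _ i
  refine ⟨v + t • u, ⟨hmem, fun w hw => (eq_of_le hmem hw hle hsum ?_ ?_).1⟩, hinc⟩
  · intro i hi hix h
    obtain ⟨m, hm, hc⟩ := hpos i hi (hinc ▸ hix) h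
    rw [hm, hc]
  · intro i hi hix h
    obtain ⟨m, hm, hc⟩ := hneg i hi (hinc ▸ hix) h
    rw [hm, hc]

end PeriodicArrangement

/-- Two maps with the same fibers have equivalent images. -/
theorem nonempty_equiv_image {α β γ : Type*} {f : α → β} {g : α → γ} {D : Set α}
    (h : ∀ x ∈ D, ∀ y ∈ D, f x = f y ↔ g x = g y) : Nonempty (f '' D ≃ g '' D) := by
  choose s hs hfs using fun c : f '' D => c.2
  refine ⟨Equiv.ofBijective (fun c => ⟨g (s c), s c, hs c, rfl⟩) ⟨fun c d hcd => ?_, ?_⟩⟩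
  · have := (h _ (hs c) _ (hs d)).2 (congrArg Subtype.val hcd)
    rw [hfs, hfs] at this
    exact Subtype.ext this
  · rintro ⟨_, x, hx, rfl⟩
    refine ⟨⟨f x, x, hx, rfl⟩, Subtype.ext ((h _ (hs _) _ hx).1 (hfs _))⟩

/-! ### Cells projected to the torus. -/

namespace PeriodicArrangement

variable {n : ℕ} {ι : Type*} {P : PeriodicArrangement n ι}

theorem torusMk_mem_image_cell {x y : Fin n → ℝ} :
    torusMk n y ∈ torusMk n '' P.cell x ↔ ∃ z, P.code (y + intVec z) = P.code x := by
  constructor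
  · rintro ⟨w, hw, hwy⟩
    obtain ⟨z, rfl⟩ := torusMk_eq_iff.1 hwy.symm
    exact ⟨z, hw⟩
  · rintro ⟨z, hz⟩
    exact ⟨y + intVec z, hz, by rw [map_add, torusMk_intVec, add_zero]⟩

/-- Lattice translations permute the cells, so two projected cells coincide as soon as they share a
point. -/
theorem image_cell_eq_iff {x y : Fin n → ℝ} :
    torusMk n '' P.cell y = torusMk n '' P.cell x ↔ ∃ z, P.code (y + intVec z) = P.code x := by
  rw [← torusMk_mem_image_cell]
  constructor
  · intro h
    rw [← h]
    exact mem_image_of_mem _ rfl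
  · intro h
    obtain ⟨z, hz⟩ := torusMk_mem_image_cell.1 h
    ext v
    obtain ⟨w, rfl⟩ := surjective_torusMk v
    rw [torusMk_mem_image_cell, torusMk_mem_image_cell]
    constructor
    · rintro ⟨z', hz'⟩
      refine ⟨z' + z, ?_⟩
      rw [← hz, ← (code_add_intVec_inj z).2 hz', add_assoc]
      congr 2
      funext i
      simp [intVec]
    · rintro ⟨z', hz'⟩
      refine ⟨z' - z, (code_add_intVec_inj z).1 ?_⟩
      rw [hz, ← hz', add_assoc]
      congr 2
      funext i
      simp [intVec]

variable [Fintype ι]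

/-- Every lattice orbit meets the unit cube, on which only finitely many codes occur. -/
theorem finite_image_cell (P : PeriodicArrangement n ι) :
    (range fun x => torusMk n '' P.cell x).Finite := by
  have h := (P.finite_code_image (isCompact_Icc (a := (0 : Fin n → ℝ)) (b := 1))).image
    fun c => torusMk n '' {w | P.code w = c}
  refine h.subset ?_
  rintro _ ⟨x, rfl⟩
  refine ⟨_, ⟨x + intVec fun i => -⌊x i⌋, ⟨fun i => ?_, fun i => ?_⟩, rfl⟩, ?_⟩
  · simp only [intVec, Pi.add_apply, Int.cast_neg, Pi.zero_apply]
    linarith [Int.floor_le (x i)]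
  · simp only [intVec, Pi.add_apply, Int.cast_neg, Pi.one_apply]
    linarith [Int.lt_floor_add_one (x i)]
  · exact (image_cell_eq_iff.2 ⟨_, rfl⟩).symm

/-- The cells of the torus are the connected components of the strata. -/
theorem image_cell_eq_connectedComponentIn {F : Set (UnitAddTorus (Fin n))} {x : Fin n → ℝ}
    (hF : ∀ w, torusMk n w ∈ F ↔ P.inc w = P.inc x) :
    torusMk n '' P.cell x = connectedComponentIn F (torusMk n x) := by
  choose U hUo hU using P.exists_isOpen_inter_eq_cell
  -- Projected cells are relatively open in the stratum `F`.
  have key : ∀ y, P.inc y = P.inc x → F ∩ torusMk n '' U y = torusMk n '' P.cell y := by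
    intro y hy
    rw [hU y, hy]
    ext v
    constructor
    · rintro ⟨hv, u, hu, rfl⟩
      exact ⟨u, ⟨hu, (hF u).1 hv⟩, rfl⟩
    · rintro ⟨u, ⟨hu, hu'⟩, rfl⟩
      exact ⟨(hF u).2 hu', u, hu, rfl⟩
  have hxF : torusMk n x ∈ F := (hF x).2 rfl
  refine Subset.antisymm ?_ ?_
  · refine IsPreconnected.subset_connectedComponentIn ?_ (mem_image_of_mem _ rfl) ?_
    · exact (convex_cell x).isPreconnected.image _ continuous_torusMk.continuousOn
    · exact (key x rfl).ge.trans inter_subset_left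
  -- `V` is an open set covering all other cells of the stratum; a connected subset of `F` cannot
  -- meet both it and the cell of `x`.
  · set V : Set (UnitAddTorus (Fin n)) :=
      ⋃ y ∈ {y | P.inc y = P.inc x ∧ torusMk n y ∉ torusMk n '' P.cell x}, torusMk n '' U y
    have hmemU : ∀ y, P.inc y = P.inc x → torusMk n y ∈ torusMk n '' U y := fun y hy =>
      ((key y hy).ge (mem_image_of_mem _ rfl)).2
    have hdisj : ∀ v ∈ F, v ∈ V → v ∉ torusMk n '' P.cell x := by
      intro v hv hvV hvx
      obtain ⟨y, ⟨hy, hyx⟩, hvy⟩ := mem_iUnion₂.1 hvV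
      have hvy : v ∈ torusMk n '' P.cell y := (key y hy).le ⟨hv, hvy⟩
      obtain ⟨w, rfl⟩ := surjective_torusMk v
      have h1 := image_cell_eq_iff.2 (torusMk_mem_image_cell.1 hvy)
      have h2 := image_cell_eq_iff.2 (torusMk_mem_image_cell.1 hvx)
      rw [← h2, h1] at hyx
      exact hyx (mem_image_of_mem _ rfl)
    have hsub := connectedComponentIn_subset F (torusMk n x)
    have hcover : connectedComponentIn F (torusMk n x) ⊆ torusMk n '' U x ∪ V := by
      intro v hv
      obtain ⟨w, rfl⟩ := surjective_torusMk v
      have hw := (hF w).1 (hsub hv)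
      by_cases hwx : torusMk n w ∈ torusMk n '' P.cell x
      · exact Or.inl ((key x rfl).ge hwx).2
      · exact Or.inr (mem_biUnion (x := w) ⟨hw, hwx⟩ (hmemU w hw))
    have hinter : connectedComponentIn F (torusMk n x) ∩ (torusMk n '' U x ∩ V) = ∅ :=
      eq_empty_of_forall_notMem fun v hv =>
        hdisj v (hsub hv.1) hv.2.2 ((key x rfl).le ⟨hsub hv.1, hv.2.1⟩)
    rcases isPreconnected_iff_subset_of_disjoint.1 isPreconnected_connectedComponentIn _ _
      (isOpenMap_torusMk _ (hUo x)) (isOpen_biUnion fun y _ => isOpenMap_torusMk _ (hUo y))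
      hcover hinter with h | h
    · exact (subset_inter hsub h).trans (key x rfl).le
    · exact absurd (mem_image_of_mem (torusMk n) (show x ∈ P.cell x from rfl))
        (hdisj _ hxF (h (mem_connectedComponentIn hxF)))

end PeriodicArrangement

/-! ### Flats as incidence strata, and their lowest vertices. -/

namespace ToricArrangement

variable {n : ℕ} (A : ToricArrangement n)

open Classical in
/-- The hyperplanes of the arrangement through a point. -/
def incident (v : UnitAddTorus (Fin n)) : Finset (Set (UnitAddTorus (Fin n))) :=
  A.hyperplanes.filter (v ∈ ·)

variable {A}

theorem mem_incident {v : UnitAddTorus (Fin n)} {H : Set (UnitAddTorus (Fin n))} :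
    H ∈ A.incident v ↔ H ∈ A.hyperplanes ∧ v ∈ H := by
  simp [incident]

theorem incident_subset (v : UnitAddTorus (Fin n)) : A.incident v ⊆ A.hyperplanes :=
  fun _ h => (mem_incident.1 h).1

theorem subset_incident_iff {S : Finset (Set (UnitAddTorus (Fin n)))} (hS : S ⊆ A.hyperplanes)
    {v : UnitAddTorus (Fin n)} : S ⊆ A.incident v ↔ v ∈ ⋂ H ∈ S, H := by
  rw [mem_iInter₂]
  exact ⟨fun h H hH => (mem_incident.1 (h hH)).2, fun h H hH => mem_incident.2 ⟨hS hH, h H hH⟩⟩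

theorem InGeneralPosition.card_incident_le (hA : A.InGeneralPosition) (v : UnitAddTorus (Fin n)) :
    (A.incident v).card ≤ n := by
  by_contra! h
  have h1 := (subset_incident_iff (incident_subset v)).1 (Finset.Subset.refl (A.incident v))
  rw [hA.2 _ (incident_subset v) h] at h1
  exact h1

/-- By induction the flats of dimension below `k` fill out the points on more than `n - k`
hyperplanes. Removing these from the intersection over `S` leaves the points whose incident set is
exactly `S`. -/
theorem InGeneralPosition.flats_eq (hA : A.InGeneralPosition) {k : ℕ} (hk : k ≤ n) :
    A.flats k = {C | ∃ v, (A.incident v).card = n - k ∧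
      C = connectedComponentIn {w | A.incident w = A.incident v} v} := by
  induction k using Nat.strong_induction_on with
  | _ k ih =>
  rcases hk.lt_or_eq with hlt | rfl
  · have hlow : ⋃ j : Fin k, ⋃₀ A.flats j = {v | n - k < (A.incident v).card} := by
      ext v
      simp only [mem_iUnion, mem_sUnion, mem_ofPred_eq]
      constructor
      · rintro ⟨j, C, hC, hv⟩
        rw [ih j j.2 (j.2.le.trans hk)] at hC
        obtain ⟨w, hw, rfl⟩ := hC
        have : A.incident v = A.incident w :=
          connectedComponentIn_subset {u | A.incident u = A.incident w} w hv
        rw [this, hw]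
        have := j.2
        omega
      · intro hv
        have h1 := hA.card_incident_le v
        have h2 : n - (A.incident v).card < k := by omega
        refine ⟨⟨_, h2⟩, connectedComponentIn {w | A.incident w = A.incident v} v, ?_,
          mem_connectedComponentIn rfl⟩
        rw [ih _ h2 (by omega)]
        exact ⟨v, by omega, rfl⟩
    have hstr : ∀ S ⊆ A.hyperplanes, S.card = n - k →
        (⋂ H ∈ S, H) \ (⋃ j : Fin k, ⋃₀ A.flats j) = {w | A.incident w = S} := by
      intro S hS hcard
      ext v
      rw [hlow, mem_sdiff, ← subset_incident_iff hS, mem_ofPred_eq, mem_ofPred_eq, not_lt, ← hcard]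
      exact ⟨fun h => (Finset.eq_of_subset_of_card_le h.1 h.2).symm, fun h => by simp [h]⟩
    rw [flats, if_pos hlt]
    ext C
    constructor
    · rintro ⟨S, hS, hcard, hC⟩
      rw [hstr S hS hcard] at hC
      obtain ⟨v, hv, rfl⟩ := hC
      rw [mem_ofPred_eq] at hv
      exact ⟨v, hv ▸ hcard, by rw [hv]⟩
    · rintro ⟨v, hv, rfl⟩
      refine ⟨A.incident v, incident_subset v, hv, ?_⟩
      rw [hstr _ (incident_subset v) hv]
      exact ⟨v, rfl, rfl⟩
  · have hstr : (univ \ ⋃ H ∈ A.hyperplanes, H) = {w | A.incident w = ∅} := by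
      ext v
      simp [Finset.eq_empty_iff_forall_notMem, mem_incident]
    rw [flats, if_neg (lt_irrefl _), if_pos rfl, hstr]
    ext C
    simp only [componentsOf, mem_ofPred_eq, Nat.sub_self, Finset.card_eq_zero]
    refine exists_congr fun v => and_congr_right fun h => ?_
    rw [h]

theorem exists_lift (A : ToricArrangement n) : ∃ P : PeriodicArrangement n A.hyperplanes,
    ∀ x, A.incident (torusMk n x) = (P.inc x).map (Function.Embedding.subtype _) := by
  choose L b h1 h2 using fun H : A.hyperplanes => (A.isToricHyperplane H H.2).exists_lift
  refine ⟨⟨L, b, h2⟩, fun x => ?_⟩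
  ext H
  simp only [mem_incident, Finset.mem_map, Function.Embedding.subtype_apply,
    PeriodicArrangement.mem_inc, Subtype.exists, exists_and_right, exists_eq_right]
  constructor
  · rintro ⟨hH, hx⟩
    exact ⟨hH, (h1 ⟨H, hH⟩ x).1 hx⟩
  · rintro ⟨hH, hx⟩
    exact ⟨hH, (h1 ⟨H, hH⟩ x).2 hx⟩

/-- The intersection of the hyperplanes through a point contains the image of `x + P.ker (P.inc x)`,
so the bound on Hausdorff dimension bounds the dimension of the kernel. -/
theorem InGeneralPosition.isSimple (hA : A.InGeneralPosition)
    {P : PeriodicArrangement n A.hyperplanes}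
    (hP : ∀ x, A.incident (torusMk n x) = (P.inc x).map (Function.Embedding.subtype _)) :
    P.IsSimple := by
  intro x
  have hcard : (A.incident (torusMk n x)).card = (P.inc x).card := by rw [hP, Finset.card_map]
  have hle := hA.card_incident_le (torusMk n x)
  have h1 := hA.1 _ (incident_subset (torusMk n x)) hle
  have h2 := finrank_le_dimH (P.ker (P.inc x)) x (⋂ H ∈ A.incident (torusMk n x), H) ?_
  · have := h2.trans h1
    rw [hcard] at this hle
    have : Module.finrank ℝ (P.ker (P.inc x)) ≤ n - (P.inc x).card := by exact_mod_cast this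
    omega
  · intro u hu
    rw [← subset_incident_iff (incident_subset _), hP, hP]
    refine Finset.map_subset_map.2 fun i hi => ?_
    obtain ⟨m, hm⟩ := PeriodicArrangement.mem_inc.1 hi
    exact PeriodicArrangement.mem_inc.2
      ⟨m, by rw [PeriodicArrangement.value_add, PeriodicArrangement.mem_ker.1 hu i hi, add_zero, hm]⟩

/-- Pairs of a vertex and `n - k` of the hyperplanes through it. -/
def vertexFlags (A : ToricArrangement n) (k : ℕ) :
    Set (UnitAddTorus (Fin n) × Finset (Set (UnitAddTorus (Fin n)))) :=
  {p | (A.incident p.1).card = n ∧ p.2 ⊆ A.incident p.1 ∧ p.2.card = n - k}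

open Classical in
/-- Taking complements among the hyperplanes through a vertex. -/
def vertexFlagsEquiv (A : ToricArrangement n) {k : ℕ} (hk : k ≤ n) :
    A.vertexFlags k ≃ A.vertexFlags (n - k) where
  toFun p := ⟨(p.1.1, A.incident p.1.1 \ p.1.2), p.2.1, Finset.sdiff_subset, by
    rw [Finset.card_sdiff_of_subset p.2.2.1, p.2.1, p.2.2.2]⟩
  invFun p := ⟨(p.1.1, A.incident p.1.1 \ p.1.2), p.2.1, Finset.sdiff_subset, by
    rw [Finset.card_sdiff_of_subset p.2.2.1, p.2.1, p.2.2.2]; omega⟩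
  left_inv p := Subtype.ext (Prod.ext rfl (Finset.sdiff_sdiff_eq_self p.2.2.1))
  right_inv p := Subtype.ext (Prod.ext rfl (Finset.sdiff_sdiff_eq_self p.2.2.1))

theorem InGeneralPosition.flats_eq_image (hA : A.InGeneralPosition)
    {P : PeriodicArrangement n A.hyperplanes}
    (hP : ∀ x, A.incident (torusMk n x) = (P.inc x).map (Function.Embedding.subtype _))
    {k : ℕ} (hk : k ≤ n) :
    A.flats k = (fun x => torusMk n '' P.cell x) '' {x | (P.inc x).card = n - k} := by
  have hcomp : ∀ x, torusMk n '' P.cell x = connectedComponentIn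
      {w | A.incident w = A.incident (torusMk n x)} (torusMk n x) := by
    refine fun x => PeriodicArrangement.image_cell_eq_connectedComponentIn fun w => ?_
    rw [mem_ofPred_eq, hP, hP, Finset.map_inj]
  rw [hA.flats_eq hk]
  ext C
  constructor
  · rintro ⟨v, hv, rfl⟩
    obtain ⟨x, rfl⟩ := surjective_torusMk v
    rw [hP, Finset.card_map] at hv
    exact ⟨x, hv, hcomp x⟩
  · rintro ⟨x, hx, rfl⟩
    exact ⟨torusMk n x, by rw [hP, Finset.card_map]; exact hx, hcomp x⟩

/-- A flat corresponds to its lowest vertex with the hyperplanes containing the flat. -/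
theorem nonempty_flats_equiv_vertexFlags (hspan : A.IsSpanning) (hA : A.InGeneralPosition)
    {k : ℕ} (hk : k ≤ n) : Nonempty (A.flats k ≃ A.vertexFlags k) := by
  obtain ⟨P, hP⟩ := A.exists_lift
  have hsimple := hA.isSimple hP
  obtain ⟨l, hl⟩ := P.exists_isGeneric
  obtain ⟨x₀, hx₀⟩ : ∃ x, (P.inc x).card = n := by
    obtain ⟨S, hS, hcard, v, hv⟩ := hspan
    obtain ⟨x, rfl⟩ := surjective_torusMk v
    refine ⟨x, le_antisymm (by have := hsimple x; omega) ?_⟩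
    have := Finset.card_le_card ((subset_incident_iff hS).2 hv)
    rwa [hcard, hP, Finset.card_map] at this
  choose bot hbot using PeriodicArrangement.exists_isBottom hsimple hx₀ l
  have himage : (fun x => (torusMk n (bot x), A.incident (torusMk n x))) ''
      {x | (P.inc x).card = n - k} = A.vertexFlags k := by
    ext ⟨v, T⟩
    constructor
    · rintro ⟨x, hx, h⟩
      obtain ⟨rfl, rfl⟩ := Prod.ext_iff.1 h
      simp only [vertexFlags, mem_ofPred_eq, hP, Finset.card_map]
      exact ⟨(hbot x).card_inc hsimple hl,
        Finset.map_subset_map.2 (PeriodicArrangement.inc_subset (hbot x).1), hx⟩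
    · rintro ⟨h1, h2, h3⟩
      obtain ⟨w, rfl⟩ := surjective_torusMk v
      simp only [hP, Finset.card_map] at h1 h2 h3
      obtain ⟨T, hT, rfl⟩ := Finset.subset_map_iff.1 h2
      obtain ⟨x, hx, rfl⟩ := PeriodicArrangement.exists_isBottom_of_subset hsimple hl h1 hT
      rw [Finset.card_map] at h3
      refine ⟨x, h3, Prod.ext ?_ (hP x)⟩
      exact congrArg (torusMk n) (hx.unique hsimple hl (hbot x))
  rw [← himage, hA.flats_eq_image hP hk]
  -- Flats and flags are both images of the same set of points `x`, so it suffices that the two maps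
  -- have equal fibres: uniqueness of lowest points gives one direction, `IsBottom.code_eq` the
  -- other.
  refine nonempty_equiv_image fun x _ y _ => ?_
  rw [PeriodicArrangement.image_cell_eq_iff, Prod.ext_iff, torusMk_eq_iff, hP, hP, Finset.map_inj]
  constructor
  · rintro ⟨z, hz⟩
    refine ⟨⟨z, (((hbot x).add_intVec z).congr hz).unique hsimple hl (hbot y)⟩, ?_⟩
    rw [← PeriodicArrangement.inc_eq_of_code_eq hz, PeriodicArrangement.inc_add_intVec]
  · rintro ⟨⟨z, hz⟩, hinc⟩
    refine ⟨z, ((hbot x).add_intVec z).code_eq hsimple hl (hz ▸ hbot y) ?_⟩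
    rw [PeriodicArrangement.inc_add_intVec, hinc]

end ToricArrangement

end

theorem mainTheorem1 {n : ℕ} (A : ToricArrangement n) (hcard : n ≤ A.hyperplanes.card)
    (hspan : A.IsSpanning) (hgen : A.InGeneralPosition) :
    (∀ k ≤ n, (A.flats k).Finite ∧ Nonempty (A.flats k ≃ A.flats (n - k)) ∧
      A.numFlats k = A.numFlats (n - k)) ∧
    ∀ i : Fin (n + 1), A.fVector i = A.fVector i.rev := by
  have key : ∀ k ≤ n, (A.flats k).Finite ∧ Nonempty (A.flats k ≃ A.flats (n - k)) ∧
      A.numFlats k = A.numFlats (n - k) := by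
    intro k hk
    obtain ⟨e⟩ := ToricArrangement.nonempty_flats_equiv_vertexFlags hspan hgen hk
    obtain ⟨e'⟩ := ToricArrangement.nonempty_flats_equiv_vertexFlags hspan hgen (Nat.sub_le n k)
    have E := (e.trans (A.vertexFlagsEquiv hk)).trans e'.symm
    refine ⟨?_, ⟨E⟩, Nat.card_congr E⟩
    obtain ⟨P, hP⟩ := A.exists_lift
    rw [hgen.flats_eq_image hP hk]
    exact P.finite_image_cell.subset (image_subset_range _ _)
  refine ⟨key, fun i => ?_⟩
  have := (key i (Nat.lt_succ_iff.1 i.2)).2.2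
  simpa [ToricArrangement.fVector, Fin.val_rev] using this
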